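/- Let $V=\{1,\dots,n\}$. For a directed graph $G=(V,E)$, $E\subseteq V\times V$, in which every vertex has an out-neighbour, let $\mathsf{RW}^G_L(u)$ denote the distribution of the $L$-step random walk $(v_0,\dots,v_L)$ with $v_0=u$ in which each $v_i$, $1 \le i \le L$, is a uniformly random out-neighbour of $v_{i-1}$. A randomized streaming algorithm is *oblivious to the start vertex* if it consists of a preprocessing phase, which makes some number of passes over the stream of the edges of $G$ (each edge listed once, in an arbitrary order) without knowing the start vertex and then outputs a string $M$, followed by a sampling phase, which receives only $M$ and the start vertex $u_{\mathsf{start}}$ (and the random bits) and outputs a sequence in $V^{L+1}$. Its *space* is the least $S$ such that each phase uses at most $S$ words of working memory and $M$ has at most $S$ words; the output tape and the random bits are not counted. Words have $O(\log n)$ bits. **Theorem (lower bound for oblivious algorithms).** Let $\log$ be the logarithm to a fixed base $b>1$ and let words have at most $B\log n$ bits for a fixed constant $B$. There are constants $k\in\mathbb N$, $c>0$ and $n_0$, depending only on $b$ and $B$, such that the following holds for all integers $n\ge n_0$ and $L\in[\log^{40}n,\,n]$. Let $\mathbb A$ be a randomized algorithm that is oblivious to the start vertex, with any number of passes, and that,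 for every such $n$-vertex directed graph $G$, every order of its edges and every start vertex $u_{\mathsf{start}}$, samples from a distribution $\mathcal D$ on $V^{L+1}$ with $$\|\mathcal D-\mathsf{RW}^G_L(u_{\mathsf{start}})\|_{\mathrm{TV}}\le 1-\frac1{\log^{10}n}.$$ Then $\mathbb A$ uses space at least $c\,n\sqrt L/\log^k n$, i.e. $\widetilde\Omega(n\sqrt L)$. In fact, however much working memory the two phases use, the maximal length of the string $M$ passed between them is at least $c\,n\sqrt L/\log^k n$ words. -/

import Mathlib

namespace RandomWalkStreaming

/-- The out-neighbourhood of `u`. A `Digraph` is a set of ordered pairs of vertices: no multi-edges,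
self-loops allowed. -/
noncomputable def outNbrs {V : Type*} [Fintype V] (G : Digraph V) (u : V) : Finset V := by
  classical exact Finset.univ.filter fun v => G.Adj u v

/-- Every vertex has an out-neighbour, so that random walks of every length are defined. -/
def NoSink {V : Type*} [Fintype V] (G : Digraph V) : Prop :=
  ∀ u, (outNbrs G u).Nonempty

/-- The law of the `L`-step random walk `(v₀, …, v_L)` with `v₀ = u`, each next vertex being a
uniformly random out-neighbour of the current one. -/
noncomputable def walkLaw {V : Type*} [Fintype V] (G : Digraph V) (hG : NoSink G) :
    (L : ℕ) → V → PMF (Fin (L + 1) → V)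
  | 0, u => PMF.pure fun _ => u
  | L + 1, u =>
      (PMF.uniformOfFinset (outNbrs G u) (hG u)).bind fun v =>
        (walkLaw G hG L v).map fun walk => Fin.cons u walk

/-- Total variation distance of two distributions on a finite set. -/
noncomputable def tvDist {α : Type*} [Fintype α] (P Q : PMF α) : ℝ :=
  (1 / 2) * ∑ a, |(P a).toReal - (Q a).toReal|

/-- `stream` lists every edge of `G` exactly once (in an arbitrary order). -/
def IsEdgeStream {V : Type*} (G : Digraph V) (stream : List (V × V)) : Prop :=
  stream.Nodup ∧ ∀ e, e ∈ stream ↔ G.Adj e.1 e.2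

/-- The contents of a memory of `s` words of `w` bits each. -/
abbrev Memory (w s : ℕ) : Type := Fin s → BitVec w

/-- Strings of at most `s` words of `w` bits each. -/
abbrev Message (w s : ℕ) : Type := {l : List (BitVec w) // l.length ≤ s}

/-- A randomized multi-pass streaming algorithm, oblivious to the start vertex, which outputs
sequences of `L + 1` vertices of an `n`-vertex graph, with words of `w` bits. The model is
non-uniform. Its random tape may be read repeatedly, by both phases, and neither the tape,
nor the clock, nor the write-only output tape is charged for. Since for a given tape there are only
finitely many behaviours, discrete distributions of the tape lose no generality. -/
structure ObliviousAlgorithm (n L w : ℕ) where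
  /-- the random tape and its distribution -/
  Seed : Type
  seed : PMF Seed
  /-- the number of passes over the stream -/
  passes : ℕ
  /-- working memory of the preprocessing phase, in words -/
  prepWords : ℕ
  /-- maximal length of the string handed to the sampling phase, in words -/
  msgWords : ℕ
  /-- working memory of the sampling phase, in words -/
  sampWords : ℕ
  /-- initial memory of the preprocessing phase -/
  init : Seed → Memory w prepWords
  /-- `step r k i m e`: the memory after reading the edge `e` at position `i` of the stream in
  pass `k`, if it was `m` before -/
  step : Seed → ℕ → ℕ → Memory w prepWords → Fin n × Fin n → Memory w prepWords
  /-- the output of the preprocessing phase -/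
  message : Seed → Memory w prepWords → Message w msgWords
  /-- initial memory of the sampling phase, which knows the message and the start vertex -/
  sampInit : Seed → Message w msgWords → Fin n → Memory w sampWords
  /-- the sampling phase, with read access to the message and the start vertex, writes the `i`-th
  vertex on the output tape and updates its memory -/
  emit : Seed → Message w msgWords → Fin n → ℕ → Memory w sampWords → Fin n × Memory w sampWords

namespace ObliviousAlgorithm

variable {n L w : ℕ} (A : ObliviousAlgorithm n L w)

/-- The memory of the preprocessing phase after the first `k` passes over the stream. -/
def prepMemory (r : A.Seed) (stream : List (Fin n × Fin n)) : ℕ → Memory w A.prepWords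
  | 0 => A.init r
  | k + 1 =>
      stream.zipIdx.foldl (fun m e => A.step r k e.2 m e.1) (prepMemory r stream k)

/-- The string that the preprocessing phase outputs after all its passes. -/
def prepOutput (r : A.Seed) (stream : List (Fin n × Fin n)) : Message w A.msgWords :=
  A.message r (A.prepMemory r stream A.passes)

/-- The memory of the sampling phase after it has written `i` vertices. -/
def sampMemory (r : A.Seed) (M : Message w A.msgWords) (u : Fin n) : ℕ → Memory w A.sampWords
  | 0 => A.sampInit r M u
  | i + 1 => (A.emit r M u i (sampMemory r M u i)).2

/-- The sequence of vertices that the sampling phase outputs. -/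
def sampOutput (r : A.Seed) (M : Message w A.msgWords) (u : Fin n) : Fin (L + 1) → Fin n :=
  fun i => (A.emit r M u i (A.sampMemory r M u i)).1

/-- The distribution of the output on a given edge stream and start vertex. -/
noncomputable def outputLaw (stream : List (Fin n × Fin n)) (u : Fin n) :
    PMF (Fin (L + 1) → Fin n) :=
  A.seed.map fun r => A.sampOutput r (A.prepOutput r stream) u

/-- The algorithm samples the `L`-step random walk within total variation distance `ε`, for every
graph on which random walks are defined, every order of its edges and every start vertex. -/
def SamplesWalks (ε : ℝ) : Prop :=
  ∀ (G : Digraph (Fin n)) (hG : NoSink G) (stream : List (Fin n × Fin n)),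
    IsEdgeStream G stream → ∀ u : Fin n,
      tvDist (A.outputLaw stream u) (walkLaw G hG L u) ≤ ε

/-- The space used, in words: the least `S` that bounds the working memory of both phases and the
length of the string passed between them. -/
def space : ℕ := max (max A.prepWords A.sampWords) A.msgWords

end ObliviousAlgorithm

end RandomWalkStreaming

/-! The hard graphs hide independent random bits that a walk must reveal. Take about `n / (2m)`
disjoint clusters of `2m` vertices with `m ≈ √(L/2)`; each index `i < m` of a cluster has two
copies. For every ordered pair `(i, j)` one bit decides which copy of `j` is the out-neighbour of
both copies of `i`. Vertices outside the clusters decode arbitrarily, so they too have out-edges. A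
walk started in a cluster stays there and follows i.i.d. uniform indices, so it reveals at least `d
≈ m²/4` distinct bits except with probability `2^(-L/2)` (`one_sub_le_walkLaw_reveals`). An
algorithm at distance at most `1 - δ` therefore outputs a correct revealing sequence with
probability at least `δ/2` for every input and cluster, and some fixed tape succeeds for a `δ/2`
fraction of these pairs. With tape, message and start vertex fixed, the output is fixed and fits at
most a `2⁻ᵈ` fraction of the cluster's bit tables. Independence of the clusters bounds the
exponential moment of the number of successes, so `C` clusters force `d·δC/2 ≤ log₂(#messages) + C`
(`mul_average_accepted_le`, `mul_le_msgWords`). As `d·C` is of order `n√L`, the bound follows. -/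

namespace RandomWalkStreaming

open Finset

/-! ### Total variation, averaging and uniform distributions -/

section Probability

/-- An event of `Q` has at most `tvDist P Q` less probability under `P`. -/
theorem sum_sub_tvDist_le {α : Type*} [Fintype α] (P Q : PMF α) (E : Finset α) :
    ∑ a ∈ E, (Q a).toReal - tvDist P Q ≤ ∑ a ∈ E, (P a).toReal := by
  classical
  have total : ∀ R : PMF α, ∑ a, (R a).toReal = 1 := fun R => by
    rw [← ENNReal.toReal_sum fun a _ => R.apply_ne_top a, ← tsum_fintype (L := .unconditional α),
      R.tsum_coe, ENNReal.toReal_one]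
  have split : ∀ f : α → ℝ, ∑ a, f a = ∑ a ∈ E, f a + ∑ a ∈ Eᶜ, f a := fun f =>
    (sum_add_sum_compl E f).symm
  have hP := total P
  have hQ := total Q
  rw [split] at hP hQ
  have h₁ : ∑ a ∈ E, ((Q a).toReal - (P a).toReal) ≤ ∑ a ∈ E, |(P a).toReal - (Q a).toReal| :=
    sum_le_sum fun a _ => by rw [abs_sub_comm]; exact le_abs_self _
  have h₂ : ∑ a ∈ Eᶜ, ((P a).toReal - (Q a).toReal) ≤ ∑ a ∈ Eᶜ, |(P a).toReal - (Q a).toReal| :=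
    sum_le_sum fun a _ => le_abs_self _
  rw [sum_sub_distrib] at h₁ h₂
  rw [tvDist, split]
  linarith

/-- If each of finitely many events has probability at least `ε`, then some outcome lies in at
least an `ε` fraction of them. -/
theorem exists_outcome_of_forall_le_prob {Ω ι : Type*} [Fintype ι] (p : PMF Ω) (E : ι → Set Ω)
    (ε : ℝ) (hε : ∀ i, ε ≤ (p.toOuterMeasure (E i)).toReal) :
    ∃ r, ε * Fintype.card ι ≤ Nat.card {i // r ∈ E i} := by
  classical
  obtain ⟨r₀, hr₀⟩ : ∃ r₀, ∀ r, Nat.card {i // r ∈ E i} ≤ Nat.card {i // r₀ ∈ E i} := by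
    have : Nonempty Ω := p.support_nonempty.to_type
    have hfin : (Set.range fun r => Nat.card {i // r ∈ E i}).Finite :=
      (Set.finite_Iic (Nat.card ι)).subset <| by
        rintro _ ⟨r, rfl⟩
        exact Nat.card_le_card_of_injective _ Subtype.val_injective
    obtain ⟨_, ⟨r₀, rfl⟩, h⟩ := hfin.exists_maximalFor id _ (Set.range_nonempty _)
    exact ⟨r₀, fun r => not_lt.1 fun hlt => hlt.not_ge (h ⟨r, rfl⟩ hlt.le)⟩
  refine ⟨r₀, ?_⟩
  -- The expected number of events that occur is at most its maximum over outcomes.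
  have hsum : ∑ i, p.toOuterMeasure (E i) ≤ (Nat.card {i // r₀ ∈ E i} : ENNReal) := by
    calc ∑ i, p.toOuterMeasure (E i) = ∑' r, ∑ i, (E i).indicator p r := by
          simp only [PMF.toOuterMeasure_apply]
          rw [Summable.tsum_finsetSum fun _ _ => ENNReal.summable]
      _ ≤ ∑' r, p r * (Nat.card {i // r₀ ∈ E i} : ENNReal) := by
          refine ENNReal.tsum_le_tsum fun r => ?_
          have : ∑ i, (E i).indicator p r = p r * (Nat.card {i // r ∈ E i} : ENNReal) := by
            simp only [Set.indicator_apply]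
            rw [← sum_filter, sum_const, nsmul_eq_mul, mul_comm, Nat.card_eq_fintype_card,
              Fintype.card_subtype]
          rw [this]
          gcongr
          exact hr₀ r
      _ = _ := by rw [ENNReal.tsum_mul_right, p.tsum_coe, one_mul]
  have hlt : ∀ i ∈ univ, p.toOuterMeasure (E i) ≠ ⊤ := fun i _ =>
    (ENNReal.sum_ne_top.1 (ne_top_of_le_ne_top (ENNReal.natCast_ne_top _) hsum)) i (mem_univ i)
  calc ε * Fintype.card ι = ∑ _i : ι, ε := by simp [mul_comm]
    _ ≤ ∑ i, (p.toOuterMeasure (E i)).toReal := sum_le_sum fun i _ => hε i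
    _ = (∑ i, p.toOuterMeasure (E i)).toReal := (ENNReal.toReal_sum hlt).symm
    _ ≤ _ := by simpa using ENNReal.toReal_mono (ENNReal.natCast_ne_top _) hsum

/-- An injective image of a uniform distribution is uniform. -/
theorem map_uniformOfFintype_eq_uniformOfFinset {α β : Type*} [Fintype α] [Nonempty α]
    (f : α → β) (hf : Function.Injective f) (s : Finset β) (hs : s.Nonempty)
    (h : ∀ b, b ∈ s ↔ ∃ a, f a = b) :
    (PMF.uniformOfFintype α).map f = PMF.uniformOfFinset s hs := by
  classical
  have hcard : #s = Fintype.card α := by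
    rw [← card_univ, ← card_image_of_injective univ hf]
    congr 1
    ext b
    simp [h]
  ext b
  rw [PMF.map_apply, PMF.uniformOfFinset_apply]
  split_ifs with hb
  · obtain ⟨a, rfl⟩ := (h b).1 hb
    rw [tsum_eq_single a]
    · simp [hcard]
    · intro a' ha'
      rw [if_neg fun e => ha' (hf e).symm]
  · refine ENNReal.tsum_eq_zero.2 fun a => if_neg ?_
    rintro rfl
    exact hb ((h _).2 ⟨a, rfl⟩)

theorem uniformOfFintype_pi_succ {J : Type*} [Fintype J] [Nonempty J] (L : ℕ) :
    (PMF.uniformOfFintype J).bind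
        (fun j => (PMF.uniformOfFintype (Fin L → J)).map fun js => (Fin.cons j js : Fin (L + 1) → J))
      = PMF.uniformOfFintype (Fin (L + 1) → J) := by
  classical
  ext js
  rw [PMF.bind_apply, tsum_eq_single (js 0)]
  · rw [PMF.map_apply, tsum_eq_single (Fin.tail js)]
    · rw [if_pos (Fin.cons_self_tail js).symm]
      simp only [PMF.uniformOfFintype_apply, Fintype.card_pi, prod_const, card_univ,
        Fintype.card_fin]
      rw [← ENNReal.mul_inv (by simp) (by simp)]
      push_cast
      rw [pow_succ']
    · intro ks hks
      rw [if_neg]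
      intro e
      exact hks (by rw [e, Fin.tail_cons])
  · intro j hj
    rw [PMF.map_apply, ENNReal.tsum_eq_zero.2, mul_zero]
    intro ks
    rw [if_neg]
    intro e
    exact hj (by rw [e, Fin.cons_zero])

end Probability

/-! ### Random walks driven by uniform labels -/

section Walks

variable {V J : Type*}

/-- The walk that starts at `u` and follows the labels `js`. -/
def path (next : V → J → V) : (L : ℕ) → V → (Fin L → J) → Fin (L + 1) → V
  | 0, u, _ => fun _ => u
  | L + 1, u, js => Fin.cons u (path next L (next u (js 0)) (Fin.tail js))

/-- The graph with an edge from `u` to `next u j` for each label `j`. -/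
def labelGraph (next : V → J → V) : Digraph V where
  Adj u v := ∃ j, next u j = v

theorem path_zero (next : V → J → V) (L : ℕ) (u : V) (js : Fin L → J) :
    path next L u js 0 = u := by
  cases L <;> rfl

theorem path_succ (next : V → J → V) (L : ℕ) (u : V) (js : Fin L → J) (t : Fin L) :
    path next L u js t.succ = next (path next L u js t.castSucc) (js t) := by
  induction L generalizing u with
  | zero => exact t.elim0
  | succ L ih =>
    simp only [path, Fin.cons_succ]
    refine Fin.cases ?_ (fun t => ?_) t
    · rw [path_zero, Fin.castSucc_zero, Fin.cons_zero]
    · rw [ih, ← Fin.succ_castSucc, Fin.cons_succ]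
      rfl

variable [Fintype V]

theorem mem_outNbrs_labelGraph (next : V → J → V) (u v : V) :
    v ∈ outNbrs (labelGraph next) u ↔ ∃ j, next u j = v := by
  classical exact mem_filter.trans (and_iff_right (mem_univ v))

theorem noSink_labelGraph [Nonempty J] (next : V → J → V) : NoSink (labelGraph next) :=
  fun u => ⟨next u (Classical.arbitrary J), (mem_outNbrs_labelGraph next u _).2 ⟨_, rfl⟩⟩

/-- Injectivity of `next u` makes a uniform label the same as a uniform out-neighbour, so
probabilities of walks become counts of label sequences. -/
theorem walkLaw_labelGraph [Fintype J] [Nonempty J] (next : V → J → V)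
    (hnext : ∀ u, Function.Injective (next u)) (hG : NoSink (labelGraph next)) (L : ℕ) (u : V) :
    walkLaw (labelGraph next) hG L u
      = (PMF.uniformOfFintype (Fin L → J)).map (path next L u) := by
  induction L generalizing u with
  | zero => exact (PMF.map_const _ _).symm
  | succ L ih =>
    rw [walkLaw, ← map_uniformOfFintype_eq_uniformOfFinset (next u) (hnext u) _ (hG u)
      (mem_outNbrs_labelGraph next u), PMF.bind_map, ← uniformOfFintype_pi_succ, PMF.map_bind]
    congr 1
    funext j
    rw [Function.comp_apply, ih, PMF.map_comp, PMF.map_comp]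
    rfl

theorem exists_isEdgeStream (G : Digraph V) : ∃ stream, IsEdgeStream G stream := by
  classical
  exact ⟨(univ.filter fun e : V × V => G.Adj e.1 e.2).toList, nodup_toList _, by simp⟩

-- Counting: short messages, and label sequences with few pairs

end Walks

section Counting

/-- At most a `2⁻ᵈ` fraction of the Boolean functions has prescribed values at `d` or more
points. -/
theorem two_pow_mul_card_consistent_le {T K : Type*} [Fintype T] [Fintype K] [DecidableEq K]
    (s : T → K) (b : T → Bool) (d : ℕ) (P : (K → Bool) → Prop) [DecidablePred P]
    (hP : ∀ y, P y → (∀ t, b t = y (s t)) ∧ d ≤ #(univ.image s)) :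
    2 ^ d * #{y | P y} ≤ Fintype.card (K → Bool) := by
  by_cases hd : d ≤ #(univ.image s)
  swap
  · rw [filter_false_of_mem fun y _ hy => hd (hP y hy).2]
    simp
  -- The values on the image of `s` are forced by `b`, so `y` is determined by its restriction to
  -- the complement.
  have hinj : #{y | P y} ≤ Fintype.card ({k // k ∉ univ.image s} → Bool) := by
    rw [← card_univ]
    refine card_le_card_of_injOn (fun y k => y k.1) (fun _ _ => mem_coe.2 (mem_univ _)) ?_
    intro y hy y' hy' h
    have hy := (hP y (mem_filter.1 (mem_coe.1 hy)).2).1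
    have hy' := (hP y' (mem_filter.1 (mem_coe.1 hy')).2).1
    funext k
    by_cases hk : k ∈ univ.image s
    · obtain ⟨t, -, rfl⟩ := mem_image.1 hk
      rw [← hy, ← hy']
    · exact congrFun h ⟨k, hk⟩
  calc _ ≤ 2 ^ #(univ.image s) * Fintype.card ({k // k ∉ univ.image s} → Bool) :=
        Nat.mul_le_mul (Nat.pow_le_pow_right two_pos hd) hinj
    _ = _ := by
        have := card_le_univ (univ.image s)
        simp only [Fintype.card_pi, prod_const, Fintype.card_bool, card_univ,
          Fintype.card_subtype_compl, Fintype.card_coe]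
        rw [← pow_add, Nat.add_sub_cancel' this]

/-- Short messages answer few questions: if for every message `M` and every `c`, at most a `2⁻ᵈ`
fraction of the inputs is accepted, then the exponential moment of the number of coordinates of
`x` that are accepted with the message `msg x` is small. -/
theorem sum_two_pow_accepted_le {ι Y Msg : Type*} [Fintype ι] [DecidableEq ι] [Fintype Y]
    [Fintype Msg] (msg : (ι → Y) → Msg) (acc : Msg → ι → Y → Prop) [∀ M c y, Decidable (acc M c y)]
    (d : ℕ) (hacc : ∀ M c, 2 ^ d * #{y | acc M c y} ≤ Fintype.card Y) :
    ∑ x, 2 ^ (d * #{c | acc (msg x) c (x c)})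
      ≤ Fintype.card Msg * (2 ^ Fintype.card ι * Fintype.card (ι → Y)) := by
  have hM : ∀ M, ∑ x : ι → Y, 2 ^ (d * #{c | acc M c (x c)})
      ≤ 2 ^ Fintype.card ι * Fintype.card (ι → Y) := fun M => by
    calc ∑ x : ι → Y, 2 ^ (d * #{c | acc M c (x c)})
        = ∑ x : ι → Y, ∏ c, (if acc M c (x c) then 2 ^ d else 1) := by
          refine sum_congr rfl fun x _ => ?_
          rw [prod_ite, prod_const, prod_const_one, mul_one, pow_mul]
      _ = ∏ c, ∑ y, (if acc M c y then 2 ^ d else 1) :=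
          (Fintype.prod_sum fun c y => if acc M c y then 2 ^ d else 1).symm
      -- In each coordinate the accepted inputs contribute at most `|Y|` by `hacc`, and so do the
      -- others.
      _ ≤ ∏ _c : ι, 2 * Fintype.card Y := by
          refine prod_le_prod' fun c _ => ?_
          rw [sum_ite, sum_const, sum_const, smul_eq_mul, smul_eq_mul, mul_one, mul_comm, two_mul]
          exact add_le_add (hacc M c) (card_le_univ _)
      _ = _ := by simp [mul_pow]
  calc ∑ x, 2 ^ (d * #{c | acc (msg x) c (x c)})
      ≤ ∑ x, ∑ M, 2 ^ (d * #{c | acc M c (x c)}) := sum_le_sum fun x _ =>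
        single_le_sum (f := fun M => 2 ^ (d * #{c | acc M c (x c)})) (fun _ _ => Nat.zero_le _)
          (mem_univ (msg x))
    _ = ∑ M, ∑ x : ι → Y, 2 ^ (d * #{c | acc M c (x c)}) := sum_comm
    _ ≤ ∑ _M : Msg, 2 ^ Fintype.card ι * Fintype.card (ι → Y) := sum_le_sum fun M _ => hM M
    _ = _ := by simp

/-- The average form of `sum_two_pow_accepted_le`, by convexity. -/
theorem mul_average_accepted_le {ι Y Msg : Type*} [Fintype ι] [DecidableEq ι] [Fintype Y]
    [Nonempty Y] [Fintype Msg] (msg : (ι → Y) → Msg) (acc : Msg → ι → Y → Prop)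
    [∀ M c y, Decidable (acc M c y)] (d T : ℕ)
    (hacc : ∀ M c, 2 ^ d * #{y | acc M c y} ≤ Fintype.card Y) (hT : Fintype.card Msg ≤ 2 ^ T)
    (a : ℝ) (ha : a * Fintype.card (ι → Y) ≤ ∑ x, (#{c | acc (msg x) c (x c)} : ℝ)) :
    d * a ≤ T + Fintype.card ι := by
  set X : ℝ := (Fintype.card (ι → Y) : ℝ) with hX
  have hX0 : 0 < X := by rw [hX]; exact_mod_cast Fintype.card_pos
  have hsum : ∑ x, (2 : ℝ) ^ (d * #{c | acc (msg x) c (x c)}) ≤ 2 ^ (T + Fintype.card ι) * X := by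
    have h := (sum_two_pow_accepted_le msg acc d hacc).trans (Nat.mul_le_mul_right _ hT)
    rw [← mul_assoc, ← pow_add] at h
    rw [hX]
    exact_mod_cast h
  -- Jensen for `t ↦ 2^t` with `x` uniform.
  have jensen := (convexOn_rpow_left (b := 2) two_pos).map_sum_le (t := univ)
    (w := fun _ : ι → Y => X⁻¹) (p := fun x => (d : ℝ) * #{c | acc (msg x) c (x c)})
    (fun _ _ => by positivity) (by simp [hX]) fun _ _ => Set.mem_univ _
  simp only [smul_eq_mul, ← mul_sum] at jensen
  have hle : (2 : ℝ) ^ ((d : ℝ) * a) ≤ 2 ^ ((T : ℝ) + Fintype.card ι) := by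
    calc (2 : ℝ) ^ ((d : ℝ) * a)
        ≤ 2 ^ (X⁻¹ * (d * ∑ x, (#{c | acc (msg x) c (x c)} : ℝ))) := by
          refine Real.rpow_le_rpow_of_exponent_le one_le_two ?_
          rw [inv_mul_eq_div, le_div_iff₀ hX0, mul_assoc]
          gcongr
      _ ≤ X⁻¹ * ∑ x, (2 : ℝ) ^ (d * #{c | acc (msg x) c (x c)}) := by
          refine jensen.trans_eq ?_
          congr 1
          refine sum_congr rfl fun x _ => ?_
          rw [← Real.rpow_natCast]
          push_cast
          rfl
      _ ≤ 2 ^ (T + Fintype.card ι) := by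
          rw [inv_mul_eq_div, div_le_iff₀ hX0]
          exact hsum
      _ = _ := by rw [← Real.rpow_natCast]; push_cast; rfl
  exact (Real.rpow_le_rpow_left_iff one_lt_two).1 hle

/-- Padding with `none` embeds messages into `S` entries of at most `2^w + 1 ≤ 2^(w+1)` values each.
-/
theorem finite_and_card_message_le (w S : ℕ) :
    Finite (Message w S) ∧ Nat.card (Message w S) ≤ 2 ^ ((w + 1) * S) := by
  let f : Message w S → (Fin S → Option (BitVec w)) := fun l i => l.1[(i : ℕ)]?
  have hf : Function.Injective f := by
    intro l l' h
    refine Subtype.ext (List.ext_getElem? fun i => ?_)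
    by_cases hi : i < S
    · exact congrFun h ⟨i, hi⟩
    · rw [List.getElem?_eq_none (by have := l.2; omega),
        List.getElem?_eq_none (by have := l'.2; omega)]
  have : Finite (BitVec w) := Finite.of_injective BitVec.toFin fun _ _ => BitVec.eq_of_toFin_eq
  have hw : Nat.card (BitVec w) ≤ 2 ^ w := by
    simpa using Nat.card_le_card_of_injective (BitVec.toFin (w := w))
      fun _ _ => BitVec.eq_of_toFin_eq
  refine ⟨Finite.of_injective f hf, (Nat.card_le_card_of_injective f hf).trans ?_⟩
  rw [Nat.card_pi, prod_const, card_univ, Fintype.card_fin, Finite.card_option, pow_mul]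
  refine Nat.pow_le_pow_left ?_ S
  have := Nat.one_le_two_pow (n := w)
  rw [pow_succ]
  omega

/-- Few label sequences meet only few pairs of consecutive labels. -/
theorem card_few_pairs_mul_two_pow_le (m L : ℕ) (hm : m ^ 2 ≤ L / 2) (d : ℕ) (hd : d ≤ m ^ 2 / 4)
    (S : (Fin L → Fin m) → Finset (Fin m × Fin m))
    (hS : ∀ (js : Fin L → Fin m) (t : ℕ) (ht : t + 1 < L),
      (js ⟨t, by omega⟩, js ⟨t + 1, ht⟩) ∈ S js) :
    #{js : Fin L → Fin m | ¬ d ≤ #(S js)} * 2 ^ (L / 2) ≤ m ^ L := by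
  set N := L / 2 with hN
  -- The pairs at positions `(2s, 2s+1)` are disjoint, hence independent, and each lies in `D` with
  -- probability at most `1/4`.
  have hD : ∀ D : Finset (Fin m × Fin m), 4 * #D ≤ m ^ 2 →
      4 ^ N * #{js : Fin L → Fin m | S js ⊆ D} ≤ m ^ L := by
    intro D hcard
    have hinj : #{js : Fin L → Fin m | S js ⊆ D}
        ≤ Fintype.card ((Fin N → D) × (Fin (L - 2 * N) → Fin m)) := by
      rw [← Fintype.card_coe]
      refine Fintype.card_le_of_injective (fun js =>
        (fun s => ⟨(js.1 ⟨2 * s, by omega⟩, js.1 ⟨2 * s + 1, by omega⟩),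
          (mem_filter.1 js.2).2 (hS js.1 (2 * s) (by omega))⟩,
        fun t => js.1 ⟨2 * N + t, by omega⟩)) ?_
      intro js js' h
      obtain ⟨h₁, h₂⟩ := Prod.mk.inj h
      refine Subtype.ext (funext fun t => ?_)
      by_cases ht : (t : ℕ) < 2 * N
      · have h := Prod.mk.inj (Subtype.mk.inj (congrFun h₁ ⟨t / 2, by omega⟩))
        rcases Nat.mod_two_eq_zero_or_one t with h0 | h0
        · have e : (⟨2 * (t / 2), by omega⟩ : Fin L) = t := Fin.ext (by simp; omega)
          have := h.1
          simp only [e] at this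
          exact this
        · have e : (⟨2 * (t / 2) + 1, by omega⟩ : Fin L) = t := Fin.ext (by simp; omega)
          have := h.2
          simp only [e] at this
          exact this
      · have e : (⟨2 * N + (t - 2 * N), by omega⟩ : Fin L) = t := Fin.ext (by simp; omega)
        have := congrFun h₂ ⟨t - 2 * N, by omega⟩
        simp only [e] at this
        exact this
    calc 4 ^ N * #{js : Fin L → Fin m | S js ⊆ D}
        ≤ 4 ^ N * Fintype.card ((Fin N → D) × (Fin (L - 2 * N) → Fin m)) :=
          Nat.mul_le_mul_left _ hinj
      _ = (4 * #D) ^ N * m ^ (L - 2 * N) := by simp [mul_pow, mul_assoc]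
      _ ≤ (m ^ 2) ^ N * m ^ (L - 2 * N) := by gcongr
      _ = m ^ L := by rw [← pow_mul, ← pow_add]; congr 1; omega
  -- Union bound over the at most `2^(m²) ≤ 2^N` sets `D`; against `4^(-N)` this leaves `2^(-N)`.
  have hunion : #{js : Fin L → Fin m | ¬ d ≤ #(S js)}
      ≤ ∑ D : Finset (Fin m × Fin m) with 4 * #D ≤ m ^ 2, #{js : Fin L → Fin m | S js ⊆ D} := by
    refine le_trans (card_le_card ?_) card_biUnion_le
    intro js hjs
    have hjs := (mem_filter.1 hjs).2
    refine mem_biUnion.2 ⟨S js, mem_filter.2 ⟨mem_univ _, by omega⟩,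
      mem_filter.2 ⟨mem_univ _, Subset.refl _⟩⟩
  have hcount : 4 ^ N * #{js : Fin L → Fin m | ¬ d ≤ #(S js)} ≤ 2 ^ N * m ^ L := by
    calc _ ≤ 4 ^ N * ∑ D : Finset (Fin m × Fin m) with 4 * #D ≤ m ^ 2,
            #{js : Fin L → Fin m | S js ⊆ D} := Nat.mul_le_mul_left _ hunion
      _ ≤ ∑ D : Finset (Fin m × Fin m) with 4 * #D ≤ m ^ 2, m ^ L := by
          rw [mul_sum]
          exact sum_le_sum fun D h => hD D (mem_filter.1 h).2
      _ ≤ 2 ^ (m ^ 2) * m ^ L := by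
          rw [sum_const, smul_eq_mul]
          refine Nat.mul_le_mul_right _ ((card_le_univ _).trans_eq ?_)
          simp [sq]
      _ ≤ _ := Nat.mul_le_mul_right _ (Nat.pow_le_pow_right two_pos hm)
  have h4 : (4 : ℕ) ^ N = 2 ^ N * 2 ^ N := by rw [← mul_pow]; norm_num
  rw [h4, mul_assoc] at hcount
  rw [mul_comm]
  exact Nat.le_of_mul_le_mul_left hcount (by positivity)

end Counting

/-! ### The cluster graphs and the bound on the message -/

section HardInstance

variable {n L m C : ℕ} [NeZero m] [NeZero C] (e : Fin C × Fin m × Bool ↪ Fin n)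

/-- The cluster, the index in the cluster and the bit that a vertex stands for. -/
noncomputable def decode : Fin n → Fin C × Fin m × Bool := Function.invFun e

theorem decode_apply (p : Fin C × Fin m × Bool) : decode e (e p) = p :=
  Function.leftInverse_invFun e.injective p

/-- The labelled edges of the hard graphs: a vertex of cluster `c` with index `i` has for each `j`
an edge to one of the two vertices of cluster `c` with index `j`, chosen by the bit `x c (i, j)`. -/
noncomputable def clusterNext (x : Fin C → Fin m × Fin m → Bool) (v : Fin n) (j : Fin m) : Fin n :=
  e ((decode e v).1, j, x (decode e v).1 ((decode e v).2.1, j))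

theorem clusterNext_injective (x : Fin C → Fin m × Fin m → Bool) (v : Fin n) :
    Function.Injective (clusterNext e x v) := fun j j' h => by
  have := e.injective h
  simp only [Prod.mk.injEq] at this
  exact this.2.1

/-- The pair of indices of the end points of the step `t` of a walk. -/
noncomputable def slot (o : Fin (L + 1) → Fin n) (t : Fin L) : Fin m × Fin m :=
  ((decode e (o t.castSucc)).2.1, (decode e (o t.succ)).2.1)

/-- The walk `o` agrees with the bits `y` of its cluster, and it reveals at least `d` of them. -/
def Reveals (d : ℕ) (o : Fin (L + 1) → Fin n) (y : Fin m × Fin m → Bool) : Prop :=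
  (∀ t : Fin L, (decode e (o t.succ)).2.2 = y (slot e o t)) ∧ d ≤ #(univ.image (slot e o))

/-- The new index is the label itself, whatever the past: the bits influence only which copy is
visited. -/
theorem decode_path_succ (x : Fin C → Fin m × Fin m → Bool) (u : Fin n) (js : Fin L → Fin m)
    (t : Fin L) :
    decode e (path (clusterNext e x) L u js t.succ)
      = ((decode e (path (clusterNext e x) L u js t.castSucc)).1, js t,
          x (decode e (path (clusterNext e x) L u js t.castSucc)).1
            ((decode e (path (clusterNext e x) L u js t.castSucc)).2.1, js t)) := by
  rw [path_succ, clusterNext, decode_apply]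

theorem decode_path_fst (x : Fin C → Fin m × Fin m → Bool) (u : Fin n) (js : Fin L → Fin m)
    (t : Fin (L + 1)) :
    (decode e (path (clusterNext e x) L u js t)).1 = (decode e u).1 := by
  induction t using Fin.induction with
  | zero => rw [path_zero]
  | succ t ih => rw [decode_path_succ, ih]

/-- A true walk never leaves its cluster, so it always agrees with the bits; only the number of
distinct slots is in question. -/
theorem reveals_path_iff (d : ℕ) (x : Fin C → Fin m × Fin m → Bool) (u : Fin n)
    (js : Fin L → Fin m) :
    Reveals e d (path (clusterNext e x) L u js) (x (decode e u).1)
      ↔ d ≤ #(univ.image (slot e (path (clusterNext e x) L u js))) := by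
  refine and_iff_right fun t => ?_
  simp only [slot, decode_path_succ, decode_path_fst]

/-- The random walk reveals many bits, except with exponentially small probability. -/
theorem one_sub_le_walkLaw_reveals (hm : m ^ 2 ≤ L / 2) (d : ℕ) (hd : d ≤ m ^ 2 / 4)
    (x : Fin C → Fin m × Fin m → Bool) (u : Fin n) (E : Finset (Fin (L + 1) → Fin n))
    (hE : ∀ o, o ∈ E ↔ Reveals e d o (x (decode e u).1)) :
    1 - ((2 : ℝ) ^ (L / 2))⁻¹
      ≤ ∑ o ∈ E,
          (walkLaw (labelGraph (clusterNext e x)) (noSink_labelGraph _) L u o).toReal := by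
  classical
  have hlaw : ∑ o ∈ E,
      (walkLaw (labelGraph (clusterNext e x)) (noSink_labelGraph _) L u o).toReal
      = (#{js : Fin L → Fin m | path (clusterNext e x) L u js ∈ E} : ℝ) / (m : ℝ) ^ L := by
    rw [← ENNReal.toReal_sum fun a _ => PMF.apply_ne_top _ a, ← PMF.toOuterMeasure_apply_finset,
      walkLaw_labelGraph _ (clusterNext_injective e x), PMF.toOuterMeasure_map_apply,
      PMF.toOuterMeasure_uniformOfFintype_apply]
    simp [Fintype.card_subtype]
  have hbad := card_few_pairs_mul_two_pow_le m L hm d hd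
    (fun js => univ.image (slot e (path (clusterNext e x) L u js))) fun js t ht => by
      -- Slot `0` involves the start index, which is no label; the labels `t` and `t + 1` form slot
      -- `t + 1`.
      refine mem_image.2 ⟨⟨t + 1, ht⟩, mem_univ _, ?_⟩
      have h : (⟨t + 1, ht⟩ : Fin L).castSucc = (⟨t, by omega⟩ : Fin L).succ := rfl
      rw [slot, decode_path_succ, h, decode_path_succ]
  have hsplit : #{js : Fin L → Fin m | path (clusterNext e x) L u js ∈ E}
      + #{js : Fin L → Fin m |
          ¬ d ≤ #(univ.image (slot e (path (clusterNext e x) L u js)))} = m ^ L := by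
    simp only [hE, reveals_path_iff]
    rw [card_filter_add_card_filter_not]
    simp
  have hm0 : (0 : ℝ) < (m : ℝ) ^ L := by
    have : 0 < m := Nat.pos_of_neZero m
    positivity
  have hbad' : (#{js : Fin L → Fin m |
      ¬ d ≤ #(univ.image (slot e (path (clusterNext e x) L u js)))} : ℝ)
      ≤ (m : ℝ) ^ L * ((2 : ℝ) ^ (L / 2))⁻¹ := by
    rw [← div_eq_mul_inv, le_div_iff₀ (by positivity)]
    exact_mod_cast hbad
  have hsplit' : (#{js : Fin L → Fin m | path (clusterNext e x) L u js ∈ E} : ℝ)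
      + #{js : Fin L → Fin m |
          ¬ d ≤ #(univ.image (slot e (path (clusterNext e x) L u js)))} = (m : ℝ) ^ L := by
    exact_mod_cast hsplit
  rw [hlaw, le_div_iff₀ hm0]
  linarith

/-- The message of an oblivious algorithm is long, in terms of the number `C` of clusters and of
their size `2 * m`. -/
theorem mul_le_msgWords (e : Fin C × Fin m × Bool ↪ Fin n) {w : ℕ}
    (A : ObliviousAlgorithm n L w) (δ : ℝ) (hA : A.SamplesWalks (1 - δ))
    (hδ : ((2 : ℝ) ^ (L / 2))⁻¹ ≤ δ / 2) (hm : m ^ 2 ≤ L / 2)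
    (d : ℕ) (hd : d ≤ m ^ 2 / 4) :
    d * (δ / 2 * C) ≤ (w + 1) * A.msgWords + C := by
  classical
  let start : Fin C → Fin n := fun c => e (c, 0, false)
  have hstart : ∀ c, (decode e (start c)).1 = c := fun c => by rw [decode_apply]
  choose stream hstream using fun x : Fin C → Fin m × Fin m → Bool =>
    exists_isEdgeStream (labelGraph (clusterNext e x))
  -- One tape serves all pairs of input and cluster; the probability is at least `1 - 2^(-L/2) - (1
  -- - δ) ≥ δ/2`.
  obtain ⟨r, hr⟩ := exists_outcome_of_forall_le_prob
    (ι := (Fin C → Fin m × Fin m → Bool) × Fin C) A.seed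
    (fun p => {r | Reveals e d (A.sampOutput r (A.prepOutput r (stream p.1)) (start p.2))
      (p.1 p.2)}) (δ / 2) fun ⟨x, c⟩ => by
      let E : Finset (Fin (L + 1) → Fin n) := {o | Reveals e d o (x c)}
      have hQ := one_sub_le_walkLaw_reveals e hm d hd x (start c) E fun o => by
        rw [hstart]; simp [E]
      have hP := sum_sub_tvDist_le (A.outputLaw (stream x) (start c))
        (walkLaw (labelGraph (clusterNext e x)) (noSink_labelGraph _) L (start c)) E
      have htv := hA _ (noSink_labelGraph (clusterNext e x)) (stream x) (hstream x) (start c)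
      have hprob : ∑ o ∈ E, (A.outputLaw (stream x) (start c) o).toReal = (A.seed.toOuterMeasure
          {r | Reveals e d (A.sampOutput r (A.prepOutput r (stream x)) (start c)) (x c)}).toReal := by
        rw [← ENNReal.toReal_sum fun a _ => PMF.apply_ne_top _ a,
          ← PMF.toOuterMeasure_apply_finset, ObliviousAlgorithm.outputLaw,
          PMF.toOuterMeasure_map_apply]
        congr 2
        ext r
        simp [E]
      rw [hprob] at hP
      linarith
  have hfin : Finite (Message w A.msgWords) := (finite_and_card_message_le w A.msgWords).1
  have hcard := (finite_and_card_message_le w A.msgWords).2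
  have : Fintype (Message w A.msgWords) := Fintype.ofFinite _
  rw [Nat.card_eq_fintype_card] at hcard
  have key := mul_average_accepted_le
    (fun x : Fin C → Fin m × Fin m → Bool => A.prepOutput r (stream x))
    (fun M c y => Reveals e d (A.sampOutput r M (start c)) y) d ((w + 1) * A.msgWords)
    (fun M c => two_pow_mul_card_consistent_le (slot e (A.sampOutput r M (start c)))
      (fun t => (decode e (A.sampOutput r M (start c) t.succ)).2.2) d _ fun _ hy => hy)
    hcard (δ / 2 * C) (by
      refine le_trans (le_of_eq ?_) (hr.trans (le_of_eq ?_))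
      · rw [Fintype.card_prod, Fintype.card_fin]
        push_cast
        ring
      · rw [Nat.card_eq_fintype_card, Fintype.card_subtype, ← Nat.cast_sum]
        congr 1
        simp only [card_filter, Set.mem_ofPred_eq, Fintype.sum_prod_type])
  rw [Fintype.card_fin] at key
  exact_mod_cast key

end HardInstance

end RandomWalkStreaming

/-! ### Choice of parameters -/

theorem theorem3 (b : ℝ) (hb : 1 < b) (B : ℝ) :
    ∃ (k : ℕ) (c : ℝ) (n₀ : ℕ), 0 < c ∧
      ∀ n : ℕ, n₀ ≤ n → ∀ L : ℕ, (Real.logb b n) ^ 40 ≤ (L : ℝ) → L ≤ n →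
      ∀ w : ℕ, (w : ℝ) ≤ B * Real.logb b n →
      ∀ A : RandomWalkStreaming.ObliviousAlgorithm n L w,
        A.SamplesWalks (1 - 1 / (Real.logb b n) ^ 10) →
          c * (n * Real.sqrt L) / (Real.logb b n) ^ k ≤ (A.space : ℝ) ∧
          c * (n * Real.sqrt L) / (Real.logb b n) ^ k ≤ (A.msgWords : ℝ) := by
  -- Ten logarithms come from `δ` and one from the word length; `512 = 128 · 4` from `hfinal` and
  -- `hhalf`; `n ≥ b²` gives `ℓ ≥ 2`.
  refine ⟨11, 1 / (512 * (|B| + 1)), ⌈b ^ 2⌉₊, by positivity, ?_⟩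
  intro n hn L hL hLn w hw A hA
  suffices h : 1 / (512 * (|B| + 1)) * (n * Real.sqrt L) / (Real.logb b n) ^ 11
      ≤ (A.msgWords : ℝ) by
    refine ⟨h.trans ?_, h⟩
    exact_mod_cast le_max_right (max A.prepWords A.sampWords) A.msgWords
  have hbn : b ^ 2 ≤ n := (Nat.le_ceil _).trans (by exact_mod_cast hn)
  have hℓ : 2 ≤ Real.logb b n := by
    rw [Real.le_logb_iff_rpow_le hb (lt_of_lt_of_le (by positivity) hbn)]
    exact_mod_cast hbn
  set ℓ := Real.logb b n with hℓdef
  have hℓ0 : 0 < ℓ := by linarith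
  -- sizes of the clusters
  have h30 : (2 : ℝ) ^ 30 ≤ ℓ ^ 30 := pow_le_pow_left₀ (by norm_num) hℓ 30
  have hLℓ : (2 : ℝ) ^ 30 * ℓ ^ 10 ≤ L := by
    calc (2 : ℝ) ^ 30 * ℓ ^ 10 ≤ ℓ ^ 30 * ℓ ^ 10 := by gcongr
      _ = ℓ ^ 40 := by ring
      _ ≤ L := hL
  have h10 : (1 : ℝ) ≤ ℓ ^ 10 := one_le_pow₀ (by linarith)
  have hL30 : 2 ^ 30 ≤ L := by
    have : (2 : ℝ) ^ 30 ≤ L := by nlinarith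
    exact_mod_cast this
  obtain ⟨m, hmdef⟩ : ∃ m, m = Nat.sqrt (L / 2) := ⟨_, rfl⟩
  have hm : m ^ 2 ≤ L / 2 := by rw [hmdef]; exact Nat.sqrt_le' _
  have hm' : L / 2 < (m + 1) ^ 2 := by rw [hmdef]; exact Nat.lt_succ_sqrt' _
  have hm2 : 2 ≤ m := by
    by_contra h
    have : (m + 1) ^ 2 ≤ 2 ^ 2 := Nat.pow_le_pow_left (by omega) 2
    omega
  have hLm : L ≤ 12 * m ^ 2 := by
    have : (m + 1) ^ 2 ≤ 4 * m ^ 2 := by nlinarith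
    omega
  have hmn : 2 * m ≤ n := by
    have : m ≤ m ^ 2 := Nat.le_self_pow two_ne_zero m
    omega
  obtain ⟨C, hCdef⟩ : ∃ C, C = n / (2 * m) := ⟨_, rfl⟩
  have hC1 : 1 ≤ C := by rw [hCdef]; exact (Nat.one_le_div_iff (by omega)).2 hmn
  have hCn : 2 * m * C ≤ n := by rw [hCdef]; exact Nat.mul_div_le n (2 * m)
  have hnC : n ≤ 4 * m * C := by
    have : n < 2 * m * (C + 1) := by
      rw [hCdef]
      exact Nat.lt_mul_div_succ n (by omega)
    nlinarith
  obtain ⟨d, hddef⟩ : ∃ d, d = m ^ 2 / 4 := ⟨_, rfl⟩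
  have hd : m ^ 2 ≤ 8 * d := by
    have : 2 ^ 2 ≤ m ^ 2 := Nat.pow_le_pow_left hm2 2
    omega
  have : NeZero m := ⟨by omega⟩
  have : NeZero C := ⟨by omega⟩
  obtain ⟨e⟩ : Nonempty (Fin C × Fin m × Bool ↪ Fin n) :=
    Function.Embedding.nonempty_of_card_le (by
      simp only [Fintype.card_prod, Fintype.card_fin, Fintype.card_bool]
      nlinarith)
  have hδ : ((2 : ℝ) ^ (L / 2))⁻¹ ≤ 1 / ℓ ^ 10 / 2 := by
    rw [div_div, one_div]
    refine inv_anti₀ (by positivity) ?_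
    have h1 : (L : ℝ) ≤ 3 * (L / 2 : ℕ) := by exact_mod_cast (by omega : L ≤ 3 * (L / 2))
    have h2 : ((L / 2 : ℕ) : ℝ) ≤ 2 ^ (L / 2) := by exact_mod_cast Nat.lt_two_pow_self.le
    linarith
  have key := RandomWalkStreaming.mul_le_msgWords e A (1 / ℓ ^ 10) hA hδ hm d hddef.le
  -- arithmetic
  have hdR : (m : ℝ) ^ 2 ≤ 8 * d := by exact_mod_cast hd
  have hLmR : (L : ℝ) ≤ 12 * m ^ 2 := by exact_mod_cast hLm
  have hnCR : (n : ℝ) ≤ 4 * m * C := by exact_mod_cast hnC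
  have hC1R : (1 : ℝ) ≤ C := by exact_mod_cast hC1
  have hm0 : (0 : ℝ) < m := by exact_mod_cast (by omega : 0 < m)
  have hsqrt : Real.sqrt L ≤ 4 * m := Real.sqrt_le_iff.2 ⟨by positivity, by nlinarith⟩
  have hwR : (w : ℝ) + 1 ≤ (|B| + 1) * ℓ := by
    have : B * ℓ ≤ |B| * ℓ := mul_le_mul_of_nonneg_right (le_abs_self B) hℓ0.le
    linarith
  have hdℓ : 4 * ℓ ^ 10 ≤ d := by linarith
  have hhalf : (d : ℝ) * C ≤ 4 * ℓ ^ 10 * (((|B| + 1) * ℓ) * A.msgWords) := by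
    have h1 : (d : ℝ) * C ≤ 2 * ℓ ^ 10 * ((w + 1) * A.msgWords) + 2 * ℓ ^ 10 * C := by
      have := mul_le_mul_of_nonneg_left key (by positivity : 0 ≤ 2 * ℓ ^ 10)
      have e1 : 2 * ℓ ^ 10 * (d * (1 / ℓ ^ 10 / 2 * C)) = (d : ℝ) * C := by field_simp
      linarith
    -- The additive `C` of `key` costs at most half of `d * C`; this is where `L` must dominate `ℓ ^
    -- 10`.
    have h2 : 4 * ℓ ^ 10 * C ≤ (d : ℝ) * C := by gcongr
    have h3 : ((w : ℝ) + 1) * A.msgWords ≤ ((|B| + 1) * ℓ) * A.msgWords := by gcongr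
    have h4 := mul_le_mul_of_nonneg_left h3 (by positivity : 0 ≤ 4 * ℓ ^ 10)
    linarith
  have hfinal : (n : ℝ) * Real.sqrt L ≤ 128 * (d * C) := by
    calc (n : ℝ) * Real.sqrt L ≤ (4 * m * C) * (4 * m) := by gcongr
      _ = 16 * C * (m : ℝ) ^ 2 := by ring
      _ ≤ 16 * C * (8 * d) := by gcongr
      _ = 128 * (d * C) := by ring
  rw [div_le_iff₀ (by positivity), one_div_mul_eq_div, div_le_iff₀ (by positivity)]
  calc (n : ℝ) * Real.sqrt L ≤ 128 * (4 * ℓ ^ 10 * (((|B| + 1) * ℓ) * A.msgWords)) := by linarith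
    _ = _ := by ring
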